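/- All Hilbert spaces are finite-dimensional and complex. For a quantum state $\sigma$ (a positive semidefinite operator of trace one) let $S_{\min}(\sigma)=-\log_2\|\sigma\|$, with $\|\cdot\|$ the operator norm, and let $P_m(\sigma)=\lfloor 2^{S_{\min}(\sigma)}\rfloor$ be its masking power. For $d\ge 1$, say that $\sigma$ can mask $d$-dimensional quantum information if there are Hilbert spaces $\mathcal H_A$ and $\mathcal H_B$, with $\mathbb C^d$ isometrically embedded in $\mathcal H_A$ and the space of $\sigma$ isometrically embedded in $\mathcal H_B$, and a unitary operator $V$ on $\mathcal H_A\otimes\mathcal H_B$ such that, for $\mathcal T(\rho)=V(\rho\otimes\sigma)V^\dagger$, both $\operatorname{Tr}_A\mathcal T(\rho)$ and $\operatorname{Tr}_B\mathcal T(\rho)$ are the same for all quantum states $\rho$ on $\mathbb C^d$; that is, $\sigma$ is the safe state of a $d$-dimensional randomized quantum masking process. (i) For every quantum state $\sigma$ and every integer $d\ge1$, $\sigma$ can mask $d$-dimensional quantum information if and only if $S_{\min}(\sigma)\ge\log_2 d$. (ii) The masking power, counted in qubits, is superadditive: for all quantum states $\sigma_1,\sigma_2$, $$\log_2 P_m(\sigma_1\otimes\sigma_2)\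 \ge\ \log_2 P_m(\sigma_1)+\log_2 P_m(\sigma_2).$$ Moreover, if $P_m(\sigma_1)\ge2$ and $P_m(\sigma_2)\ge2$, then also $P_m(\sigma_1\otimes\sigma_2)\ge P_m(\sigma_1)+P_m(\sigma_2)$. -/

import Mathlib

open scoped Matrix Kronecker ComplexOrder

/-- A quantum state of the finite-dimensional system with Hilbert space `ℂ^ι`: a positive
semidefinite operator of trace one, given by its matrix in the standard basis. -/
structure QState (ι : Type*) [Fintype ι] where
  /-- The density matrix of the state. -/
  mat : Matrix ι ι ℂ
  posSemidef : mat.PosSemidef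
  trace_eq_one : mat.trace = 1

namespace QState

/-- The product state `σ ⊗ τ`. -/
def tensor {ι κ : Type*} [Fintype ι] [Fintype κ] (σ : QState ι) (τ : QState κ) :
    QState (ι × κ) where
  mat := σ.mat ⊗ₖ τ.mat
  posSemidef := σ.posSemidef.kronecker τ.posSemidef
  trace_eq_one := by
    rw [Matrix.trace_kronecker, σ.trace_eq_one, τ.trace_eq_one, one_mul]

/-- The min-entropy `S_min(σ) = -log₂ ‖σ‖`, with the operator norm on the Euclidean space `ℂ^ι`. -/
noncomputable def minEntropy {ι : Type*} [Fintype ι] [DecidableEq ι] (σ : QState ι) : ℝ :=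
  -Real.logb 2 ‖Matrix.toEuclideanCLM (n := ι) (𝕜 := ℂ) σ.mat‖

/-- The masking power `P_m(σ) = ⌊2 ^ S_min(σ)⌋`. -/
noncomputable def maskingPower {ι : Type*} [Fintype ι] [DecidableEq ι] (σ : QState ι) : ℕ :=
  ⌊(2 : ℝ) ^ σ.minEntropy⌋₊

end QState

/-- The partial trace `Tr_A` over the first tensor factor. -/
def partialTraceA {α β : Type*} [Fintype α] (M : Matrix (α × β) (α × β) ℂ) : Matrix β β ℂ :=
  Matrix.of fun b b' => ∑ a, M (a, b) (a, b')

/-- The partial trace `Tr_B` over the second tensor factor. -/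
def partialTraceB {α β : Type*} [Fintype β] (M : Matrix (α × β) (α × β) ℂ) : Matrix α α ℂ :=
  Matrix.of fun a a' => ∑ b, M (a, b) (a', b)

/-- The data of a process `𝒯(ρ) = V (ρ ⊗ ζ) V†` acting on `d`-dimensional inputs, where the state
`ζ` of a system `ℂ^ι` is the source of randomness.  The Hilbert spaces are `H_A = ℂ^dimA` and
`H_B = ℂ^dimB`, and `V` is a unitary operator on `H_A ⊗ H_B`.  The `d`-dimensional input space and
the space of `ζ` are regarded as subspaces of `H_A` and of `H_B` through the isometries `inA` and
`inB`. -/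
structure RandomizedProcess (d : ℕ) (ι : Type*) [Fintype ι] [DecidableEq ι] where
  /-- The dimension of `H_A`. -/
  dimA : ℕ
  /-- The dimension of `H_B`. -/
  dimB : ℕ
  /-- The isometric inclusion of the input space in `H_A`. -/
  inA : Matrix (Fin dimA) (Fin d) ℂ
  inA_isometry : inAᴴ * inA = 1
  /-- The isometric inclusion of the space of the randomness source in `H_B`. -/
  inB : Matrix (Fin dimB) ι ℂ
  inB_isometry : inBᴴ * inB = 1
  /-- The unitary operator on `H_A ⊗ H_B`. -/
  V : Matrix (Fin dimA × Fin dimB) (Fin dimA × Fin dimB) ℂ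
  V_unitary : V ∈ Matrix.unitaryGroup (Fin dimA × Fin dimB) ℂ

namespace RandomizedProcess

variable {d : ℕ} {ι : Type*} [Fintype ι] [DecidableEq ι]

/-- The output `𝒯(ρ) = V (ρ ⊗ ζ) V†` of the process. -/
def output (P : RandomizedProcess d ι) (ζ : QState ι) (ρ : QState (Fin d)) :
    Matrix (Fin P.dimA × Fin P.dimB) (Fin P.dimA × Fin P.dimB) ℂ :=
  P.V * ((P.inA * ρ.mat * P.inAᴴ) ⊗ₖ (P.inB * ζ.mat * P.inBᴴ)) * P.Vᴴ

/-- With the safe state `ζ` the process masks quantum information: both `Tr_A 𝒯(ρ)` and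
`Tr_B 𝒯(ρ)` are independent of the input state `ρ`. -/
def IsMasking (P : RandomizedProcess d ι) (ζ : QState ι) : Prop :=
  ∀ ρ ρ' : QState (Fin d),
    partialTraceA (P.output ζ ρ) = partialTraceA (P.output ζ ρ') ∧
    partialTraceB (P.output ζ ρ) = partialTraceB (P.output ζ ρ')

end RandomizedProcess

/-- The state `σ` can mask `d`-dimensional quantum information: it is the safe state of some
`d`-dimensional randomized quantum masking process. -/
def QState.CanMask {ι : Type*} [Fintype ι] [DecidableEq ι] (σ : QState ι) (d : ℕ) : Prop :=
  ∃ P : RandomizedProcess d ι, P.IsMasking σ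

/-! Since `‖σ‖` is the largest eigenvalue, (i) says that `d`-dimensional masking is possible exactly
when `d * l i ≤ 1` for every eigenvalue `l i` of `σ`.

Necessity (`IsMasking.mul_eig_le_one`): reshape the weighted columns of the process isometry into
matrices `M i s`. By polarization, masking means `∑ i, M i s * (M i s')ᴴ = δ TA`, and likewise for
`(M i s)ᴴ * M i s'` with some `TB`. In eigenbases of `TA` and `TB`, with eigenvalues `a`, `b`, the
numbers `m = |M i s x y|²` satisfy `∑ m / a x ≤ 1` over `s, x` and `∑ m / b y ≤ 1` over `s, y`.
Summing `2 m ≤ a x * (m / b y) + b y * (m / a x)` gives `2 d * l i ≤ tr TA + tr TB = 2`.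

Sufficiency (`QState.canMask_of_mul_eig_le_one`): a coherent rank-one measurement that records its
outcome in both systems masks as soon as the outcome probabilities do not depend on the input.
Birkhoff's theorem and random signs supply one.

For (ii), `‖σ₁ ⊗ σ₂‖ ≤ ‖σ₁‖ ‖σ₂‖` and `⌊x⌋ ⌊y⌋ ≤ ⌊x y⌋`, so masking powers are supermultiplicative.
-/

open scoped Matrix.Norms.L2Operator in
theorem Matrix.norm_toEuclideanCLM_unitary_conj_diagonal {n : Type*} [Fintype n] [DecidableEq n]
    {U : Matrix n n ℂ} (hU : U ∈ Matrix.unitaryGroup n ℂ) (v : n → ℂ) :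
    ‖Matrix.toEuclideanCLM (n := n) (𝕜 := ℂ) (U * Matrix.diagonal v * Uᴴ)‖ = ‖v‖ := by
  rw [Matrix.l2_opNorm_toEuclideanCLM, ← Matrix.star_eq_conjTranspose,
    CStarRing.norm_mul_mem_unitary _ (Unitary.star_mem hU), CStarRing.norm_mem_unitary_mul _ hU,
    Matrix.l2_opNorm_diagonal]

/-! ### Spectrum, operator norm and masking power -/

namespace QState

variable {ι κ : Type*} [Fintype ι] [DecidableEq ι] [Fintype κ] [DecidableEq κ]

/-- The operator norm of the density matrix. -/
noncomputable def opNorm (σ : QState ι) : ℝ :=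
  ‖Matrix.toEuclideanCLM (n := ι) (𝕜 := ℂ) σ.mat‖

/-- The eigenvalues of the density matrix. -/
noncomputable def eig (σ : QState ι) : ι → ℝ := σ.posSemidef.isHermitian.eigenvalues

/-- The unitary matrix whose columns are eigenvectors of the density matrix. -/
noncomputable def eigU (σ : QState ι) : Matrix ι ι ℂ :=
  (σ.posSemidef.isHermitian.eigenvectorUnitary : Matrix ι ι ℂ)

theorem eigU_mem (σ : QState ι) : σ.eigU ∈ Matrix.unitaryGroup ι ℂ :=
  σ.posSemidef.isHermitian.eigenvectorUnitary.2

theorem conjTranspose_eigU_mul_eigU (σ : QState ι) : σ.eigUᴴ * σ.eigU = 1 :=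
  Unitary.star_mul_self_of_mem σ.eigU_mem

theorem eigU_mul_conjTranspose_eigU (σ : QState ι) : σ.eigU * σ.eigUᴴ = 1 :=
  Unitary.mul_star_self_of_mem σ.eigU_mem

theorem mat_eq (σ : QState ι) :
    σ.mat = σ.eigU * Matrix.diagonal (fun i => (σ.eig i : ℂ)) * σ.eigUᴴ := by
  conv_lhs => rw [σ.posSemidef.isHermitian.spectral_theorem]
  rw [Unitary.conjStarAlgAut_apply]
  rfl

theorem eig_nonneg (σ : QState ι) (i : ι) : 0 ≤ σ.eig i := σ.posSemidef.eigenvalues_nonneg i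

theorem sum_eig (σ : QState ι) : ∑ i, σ.eig i = 1 := by
  have h := σ.trace_eq_one
  rw [σ.posSemidef.isHermitian.trace_eq_sum_eigenvalues] at h
  have h' := congrArg Complex.re h
  simpa [eig] using h'

theorem opNorm_eq (σ : QState ι) : σ.opNorm = ‖fun i => (σ.eig i : ℂ)‖ := by
  rw [opNorm, mat_eq, Matrix.norm_toEuclideanCLM_unitary_conj_diagonal σ.eigU_mem]

theorem opNorm_le_iff (σ : QState ι) {c : ℝ} (hc : 0 ≤ c) :
    σ.opNorm ≤ c ↔ ∀ i, σ.eig i ≤ c := by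
  rw [opNorm_eq, pi_norm_le_iff_of_nonneg hc]
  simp [abs_of_nonneg (σ.eig_nonneg _)]

theorem opNorm_nonneg (σ : QState ι) : 0 ≤ σ.opNorm := norm_nonneg _

theorem eig_le_opNorm (σ : QState ι) (i : ι) : σ.eig i ≤ σ.opNorm :=
  (σ.opNorm_le_iff σ.opNorm_nonneg).1 le_rfl i

theorem opNorm_pos (σ : QState ι) : 0 < σ.opNorm := by
  refine σ.opNorm_nonneg.lt_of_ne fun h => ?_
  have h0 : ∀ i, σ.eig i = 0 := fun i =>
    le_antisymm (h ▸ σ.eig_le_opNorm i) (σ.eig_nonneg i)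
  simpa [h0] using σ.sum_eig

theorem opNorm_le_one (σ : QState ι) : σ.opNorm ≤ 1 :=
  (σ.opNorm_le_iff zero_le_one).2 fun i => by
    rw [← σ.sum_eig]
    exact Finset.single_le_sum (fun j _ => σ.eig_nonneg j) (Finset.mem_univ i)

theorem opNorm_tensor_le (σ : QState ι) (τ : QState κ) :
    (σ.tensor τ).opNorm ≤ σ.opNorm * τ.opNorm := by
  have h : (σ.tensor τ).mat = (σ.eigU ⊗ₖ τ.eigU) *
      Matrix.diagonal (fun p : ι × κ => (σ.eig p.1 : ℂ) * (τ.eig p.2 : ℂ)) *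
      (σ.eigU ⊗ₖ τ.eigU)ᴴ := by
    rw [Matrix.conjTranspose_kronecker,
      ← Matrix.diagonal_kronecker_diagonal (fun i => (σ.eig i : ℂ)) (fun i => (τ.eig i : ℂ)),
      ← Matrix.mul_kronecker_mul, ← Matrix.mul_kronecker_mul, ← mat_eq, ← mat_eq]
    rfl
  rw [opNorm, h, Matrix.norm_toEuclideanCLM_unitary_conj_diagonal
    (Matrix.kronecker_mem_unitary σ.eigU_mem τ.eigU_mem),
    pi_norm_le_iff_of_nonneg (mul_nonneg σ.opNorm_nonneg τ.opNorm_nonneg)]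
  rintro ⟨i, j⟩
  rw [norm_mul, Complex.norm_of_nonneg (σ.eig_nonneg i), Complex.norm_of_nonneg (τ.eig_nonneg j)]
  exact mul_le_mul (σ.eig_le_opNorm i) (τ.eig_le_opNorm j) (τ.eig_nonneg j) σ.opNorm_nonneg

theorem maskingPower_eq (σ : QState ι) : σ.maskingPower = ⌊σ.opNorm⁻¹⌋₊ := by
  have : (2 : ℝ) ^ σ.minEntropy = σ.opNorm⁻¹ := by
    rw [minEntropy, ← Real.logb_inv]
    exact Real.rpow_logb two_pos (by norm_num) (inv_pos.2 σ.opNorm_pos)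
  rw [maskingPower, this]

theorem one_le_maskingPower (σ : QState ι) : 1 ≤ σ.maskingPower := by
  rw [maskingPower_eq, Nat.one_le_floor_iff]
  exact (one_le_inv₀ σ.opNorm_pos).2 σ.opNorm_le_one

theorem maskingPower_mul_le (σ : QState ι) (τ : QState κ) :
    σ.maskingPower * τ.maskingPower ≤ (σ.tensor τ).maskingPower := by
  simp only [maskingPower_eq]
  refine Nat.le_floor ?_
  push_cast
  have h1 := Nat.floor_le (inv_nonneg.2 σ.opNorm_nonneg)
  have h2 := Nat.floor_le (inv_nonneg.2 τ.opNorm_nonneg)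
  calc (⌊σ.opNorm⁻¹⌋₊ * ⌊τ.opNorm⁻¹⌋₊ : ℝ) ≤ σ.opNorm⁻¹ * τ.opNorm⁻¹ :=
        mul_le_mul h1 h2 (Nat.cast_nonneg _) (inv_nonneg.2 σ.opNorm_nonneg)
    _ = (σ.opNorm * τ.opNorm)⁻¹ := (mul_inv _ _).symm
    _ ≤ (σ.tensor τ).opNorm⁻¹ := inv_anti₀ (opNorm_pos _) (opNorm_tensor_le σ τ)

/-- This eigenvalue form is the one in which both directions of (i) are proved. -/
theorem logb_le_minEntropy_iff (σ : QState ι) {d : ℕ} (hd : 1 ≤ d) :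
    Real.logb 2 d ≤ σ.minEntropy ↔ ∀ i, d * σ.eig i ≤ 1 := by
  have hd' : (0 : ℝ) < d := by exact_mod_cast hd
  rw [show σ.minEntropy = -Real.logb 2 σ.opNorm from rfl, ← Real.logb_inv,
    Real.logb_le_logb one_lt_two hd' (inv_pos.2 σ.opNorm_pos),
    le_inv_comm₀ hd' σ.opNorm_pos, opNorm_le_iff _ (inv_nonneg.2 hd'.le)]
  exact forall_congr' fun i => by rw [← one_div, le_div_iff₀' hd']

end QState

/-! ### The weight inequality for operators with uninformative marginals -/

/-- If `N Nᴴ` is diagonal with entries `γ`, the columns of `γ^{-1/2} N` have norm at most one. -/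
theorem Matrix.sum_normSq_div_le_one {P K : Type*} [Fintype P] [DecidableEq P] [Fintype K]
    (N : Matrix P K ℂ) (γ : P → ℝ)
    (h : N * Nᴴ = Matrix.diagonal fun p => (γ p : ℂ)) (k : K) :
    ∑ p, Complex.normSq (N p k) / γ p ≤ 1 := by
  set t := ∑ p, Complex.normSq (N p k) / γ p with ht
  set x : P → ℂ := fun p => N p k / γ p with hx
  have h1 : ∑ k', Complex.normSq ((star x ᵥ* N) k') = t := by
    have e : star x ᵥ* N ⬝ᵥ star (star x ᵥ* N) = star x ⬝ᵥ (N * Nᴴ) *ᵥ x := by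
      rw [Matrix.star_vecMul, star_star, Matrix.dotProduct_mulVec, Matrix.dotProduct_mulVec,
        ← Matrix.vecMul_vecMul]
    rw [h] at e
    have e' := congrArg Complex.re e
    simp only [dotProduct, Pi.star_apply, RCLike.star_def, Complex.mul_conj, Complex.re_sum,
      Complex.ofReal_re, Matrix.mulVec_diagonal] at e'
    rw [e', ht]
    refine Finset.sum_congr rfl fun p _ => ?_
    rw [mul_left_comm, mul_comm _ (x p), Complex.mul_conj, ← Complex.ofReal_mul,
      Complex.ofReal_re]
    simp only [hx, Complex.normSq_div, Complex.normSq_ofReal]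
    -- Division by zero yields `0`, so indices with `γ p = 0` drop out of both sides.
    rcases eq_or_ne (γ p) 0 with h0 | h0
    · simp [h0]
    · field_simp
  have h2 : (star x ᵥ* N) k = t := by
    simp only [Matrix.vecMul, dotProduct, Pi.star_apply, RCLike.star_def, ht, Complex.ofReal_sum]
    refine Finset.sum_congr rfl fun p _ => ?_
    simp only [hx, map_div₀, Complex.conj_ofReal, Complex.ofReal_div, ← Complex.mul_conj]
    ring
  -- The vector `star x ᵥ* N` has squared norm `t`, and its `k`-th coordinate is `t` itself.
  have h3 : t * t ≤ t := by
    conv_rhs => rw [← h1]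
    have := Finset.single_le_sum (f := fun k' => Complex.normSq ((star x ᵥ* N) k'))
      (fun k' _ => Complex.normSq_nonneg _) (Finset.mem_univ k)
    simpa only [h2, Complex.normSq_ofReal] using this
  nlinarith

section Core

variable {n S α β : Type*} [Fintype n] [DecidableEq S] [DecidableEq α] [Fintype β]

/-- The entry is one of the nonnegative terms that add up to `a x`. Hence `a x > 0` wherever an
entry is nonzero, which makes the later divisions meaningful. -/
theorem normSq_le_of_marginal (M : n → S → Matrix α β ℂ) (a : α → ℝ)
    (h : ∀ s s', ∑ i, M i s * (M i s')ᴴ =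
      if s = s' then Matrix.diagonal (fun x => (a x : ℂ)) else 0)
    (i : n) (s : S) (x : α) (y : β) : Complex.normSq (M i s x y) ≤ a x := by
  have e := congrFun (congrFun (h s s) x) x
  simp only [Matrix.sum_apply, Matrix.mul_apply, Matrix.conjTranspose_apply, RCLike.star_def,
    Complex.mul_conj, if_true, Matrix.diagonal_apply_eq] at e
  have e' : ∑ i, ∑ y, Complex.normSq (M i s x y) = a x := by exact_mod_cast e
  rw [← e']
  refine le_trans ?_ (Finset.single_le_sum
    (f := fun i => ∑ y, Complex.normSq (M i s x y))
    (fun j _ => Finset.sum_nonneg fun _ _ => Complex.normSq_nonneg _) (Finset.mem_univ i))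
  exact Finset.single_le_sum (f := fun y => Complex.normSq (M i s x y))
    (fun _ _ => Complex.normSq_nonneg _) (Finset.mem_univ y)

variable [Fintype S] [Fintype α]

/-- Stack all `M i s` into one matrix `N` with rows `(s, x)` and columns `(i, y)`. The hypothesis
says precisely that `N * Nᴴ` is diagonal, the blocks `s ≠ s'` being zero. -/
theorem sum_normSq_div_le_one_of_marginal (M : n → S → Matrix α β ℂ) (a : α → ℝ)
    (h : ∀ s s', ∑ i, M i s * (M i s')ᴴ =
      if s = s' then Matrix.diagonal (fun x => (a x : ℂ)) else 0) (i : n) (y : β) :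
    ∑ s, ∑ x, Complex.normSq (M i s x y) / a x ≤ 1 := by
  have := Matrix.sum_normSq_div_le_one
    (Matrix.of fun (p : S × α) (k : n × β) => M k.1 p.1 p.2 k.2) (fun p => a p.2) ?_ (i, y)
  · simpa [Fintype.sum_prod_type] using this
  · ext ⟨s, x⟩ ⟨s', x'⟩
    have e := congrFun (congrFun (h s s') x) x'
    simp only [Matrix.sum_apply, Matrix.mul_apply, Matrix.conjTranspose_apply] at e
    simp only [Matrix.mul_apply, Matrix.conjTranspose_apply, Fintype.sum_prod_type,
      Matrix.of_apply, e, Matrix.diagonal_apply, Prod.mk.injEq]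
    by_cases hs : s = s' <;> simp [hs, Matrix.diagonal_apply]

variable [DecidableEq β]

/-- Termwise this is `2 ≤ a / b + b / a`; the column bounds for `M` and for its adjoints then absorb
the sums. -/
theorem sum_normSq_le_of_diagonal_marginals [Nonempty S] (M : n → S → Matrix α β ℂ)
    (a : α → ℝ) (b : β → ℝ)
    (hA : ∀ s s', ∑ i, M i s * (M i s')ᴴ =
      if s = s' then Matrix.diagonal (fun x => (a x : ℂ)) else 0)
    (hB : ∀ s s', ∑ i, (M i s)ᴴ * M i s' =
      if s = s' then Matrix.diagonal (fun x => (b x : ℂ)) else 0) (i : n) :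
    2 * ∑ s, ∑ x, ∑ y, Complex.normSq (M i s x y) ≤ ∑ x, a x + ∑ y, b y := by
  have hB' : ∀ s s', ∑ i, (M i s)ᴴ * ((M i s')ᴴ)ᴴ =
      if s = s' then Matrix.diagonal (fun x => (b x : ℂ)) else 0 := by simpa using hB
  have ns : ∀ s x y, Complex.normSq ((M i s)ᴴ y x) = Complex.normSq (M i s x y) := fun s x y => by
    simp [Matrix.conjTranspose_apply]
  have ta := fun y => sum_normSq_div_le_one_of_marginal M a hA i y
  have tb := fun x => sum_normSq_div_le_one_of_marginal (fun i s => (M i s)ᴴ) b hB' i x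
  have la := fun s x y => normSq_le_of_marginal M a hA i s x y
  have lb := fun s x y => normSq_le_of_marginal (fun i s => (M i s)ᴴ) b hB' i s y x
  simp only [ns] at tb lb
  obtain ⟨s₀⟩ := ‹Nonempty S›
  calc 2 * ∑ s, ∑ x, ∑ y, Complex.normSq (M i s x y)
      ≤ ∑ s, ∑ x, ∑ y, (a x * (Complex.normSq (M i s x y) / b y) +
          b y * (Complex.normSq (M i s x y) / a x)) := by
        simp only [Finset.mul_sum]
        refine Finset.sum_le_sum fun s _ => Finset.sum_le_sum fun x _ =>
          Finset.sum_le_sum fun y _ => ?_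
        have h0 := Complex.normSq_nonneg (M i s x y)
        have h1 := la s x y
        have h2 := lb s x y
        generalize Complex.normSq (M i s x y) = m at *
        rcases h0.eq_or_lt with h0 | h0
        · simp [← h0]
        have ha : 0 < a x := h0.trans_le h1
        have hb : 0 < b y := h0.trans_le h2
        rw [show a x * (m / b y) + b y * (m / a x) = m * (a x ^ 2 + b y ^ 2) / (a x * b y) by
          field_simp, le_div_iff₀ (mul_pos ha hb)]
        nlinarith [mul_nonneg h0.le (sq_nonneg (a x - b y))]
    _ = ∑ x, a x * ∑ s, ∑ y, Complex.normSq (M i s x y) / b y +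
        ∑ y, b y * ∑ s, ∑ x, Complex.normSq (M i s x y) / a x := by
        simp only [Finset.sum_add_distrib, Finset.mul_sum]
        congr 1
        · rw [Finset.sum_comm]
        · rw [Finset.sum_comm (s := (Finset.univ : Finset β))]
          refine (Finset.sum_congr rfl fun s _ => Finset.sum_comm).trans ?_
          rfl
    _ ≤ ∑ x, a x + ∑ y, b y := by
        refine add_le_add (Finset.sum_le_sum fun x _ => ?_) (Finset.sum_le_sum fun y _ => ?_)
        -- The column bound can be multiplied by `a x` only if `a x ≥ 0`. Any entry in row `x` shows
        -- this; without columns, `a x = 0`.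
        · rcases isEmpty_or_nonempty β with hβ | ⟨⟨y⟩⟩
          · have e := congrFun (congrFun (hA s₀ s₀) x) x
            simp [Matrix.sum_apply, Matrix.mul_apply] at e
            simp [show a x = 0 by exact_mod_cast e.symm]
          · exact mul_le_of_le_one_right ((Complex.normSq_nonneg _).trans (la s₀ x y)) (tb x)
        · rcases isEmpty_or_nonempty α with hβ | ⟨⟨x⟩⟩
          · have e := congrFun (congrFun (hB s₀ s₀) y) y
            simp [Matrix.sum_apply, Matrix.mul_apply] at e
            simp [show b y = 0 by exact_mod_cast e.symm]
          · exact mul_le_of_le_one_right ((Complex.normSq_nonneg _).trans (lb s₀ x y)) (ta y)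

theorem Matrix.re_trace_conjTranspose_mul_self {m k : Type*} [Fintype m] [Fintype k]
    (A : Matrix m k ℂ) : (Aᴴ * A).trace.re = ∑ x, ∑ y, Complex.normSq (A x y) := by
  simp only [Matrix.trace, Matrix.diag, Matrix.mul_apply, Matrix.conjTranspose_apply,
    RCLike.star_def, mul_comm (starRingEnd ℂ _), Complex.mul_conj, Complex.re_sum,
    Complex.ofReal_re]
  exact Finset.sum_comm

/-- If neither marginal of the operators `M i s` reveals `s`, the weight carried by a single `i`
is at most the trace of the marginals. -/
theorem sum_re_trace_le_of_marginals [Nonempty S] (M : n → S → Matrix α β ℂ)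
    (TA : Matrix α α ℂ) (TB : Matrix β β ℂ)
    (hA : ∀ s s', ∑ i, M i s * (M i s')ᴴ = if s = s' then TA else 0)
    (hB : ∀ s s', ∑ i, (M i s)ᴴ * M i s' = if s = s' then TB else 0) (i : n) :
    2 * ∑ s, ((M i s)ᴴ * M i s).trace.re ≤ TA.trace.re + TB.trace.re := by
  obtain ⟨s₀⟩ := ‹Nonempty S›
  have hTA : TA.IsHermitian := by
    have := hA s₀ s₀
    rw [if_pos rfl] at this
    rw [← this, Matrix.IsHermitian, Matrix.conjTranspose_sum]
    simp
  have hTB : TB.IsHermitian := by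
    have := hB s₀ s₀
    rw [if_pos rfl] at this
    rw [← this, Matrix.IsHermitian, Matrix.conjTranspose_sum]
    simp
  set U : Matrix α α ℂ := hTA.eigenvectorUnitary.1
  set W : Matrix β β ℂ := hTB.eigenvectorUnitary.1
  have hUU : U * Uᴴ = 1 := Unitary.mul_star_self_of_mem hTA.eigenvectorUnitary.2
  have hWW : W * Wᴴ = 1 := Unitary.mul_star_self_of_mem hTB.eigenvectorUnitary.2
  have hdA : Uᴴ * TA * U = Matrix.diagonal (fun x => (hTA.eigenvalues x : ℂ)) := by
    have := hTA.conjStarAlgAut_star_eigenvectorUnitary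
    rw [Unitary.conjStarAlgAut_apply] at this
    simpa [Matrix.star_eq_conjTranspose, Function.comp_def] using this
  have hdB : Wᴴ * TB * W = Matrix.diagonal (fun x => (hTB.eigenvalues x : ℂ)) := by
    have := hTB.conjStarAlgAut_star_eigenvectorUnitary
    rw [Unitary.conjStarAlgAut_apply] at this
    simpa [Matrix.star_eq_conjTranspose, Function.comp_def] using this
  -- Changing to eigenbases of `TA` on the left and `TB` on the right diagonalizes both marginals
  -- and preserves each weight `tr ((M i s)ᴴ * M i s)`.
  have key := sum_normSq_le_of_diagonal_marginals (fun i s => Uᴴ * M i s * W)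
    hTA.eigenvalues hTB.eigenvalues ?_ ?_ i
  · rw [hTA.trace_eq_sum_eigenvalues, hTB.trace_eq_sum_eigenvalues]
    simp only [← Matrix.re_trace_conjTranspose_mul_self] at key
    have e : ∀ s, ((Uᴴ * M i s * W)ᴴ * (Uᴴ * M i s * W)).trace = ((M i s)ᴴ * M i s).trace := by
      intro s
      rw [show (Uᴴ * M i s * W)ᴴ * (Uᴴ * M i s * W) = Wᴴ * ((M i s)ᴴ * (U * Uᴴ) * M i s * W) by
        simp only [Matrix.conjTranspose_mul, Matrix.conjTranspose_conjTranspose, Matrix.mul_assoc],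
        Matrix.trace_mul_comm, hUU, Matrix.mul_one, Matrix.mul_assoc, hWW, Matrix.mul_one]
    simpa only [e, Complex.re_sum, Complex.ofReal_re, Complex.coe_algebraMap] using key
  · intro s s'
    have : ∀ i, Uᴴ * M i s * W * (Uᴴ * M i s' * W)ᴴ = Uᴴ * (M i s * (M i s')ᴴ) * U := fun i => by
      rw [show Uᴴ * M i s * W * (Uᴴ * M i s' * W)ᴴ = Uᴴ * (M i s * (W * Wᴴ) * (M i s')ᴴ) * U by
        simp only [Matrix.conjTranspose_mul, Matrix.conjTranspose_conjTranspose, Matrix.mul_assoc],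
        hWW, Matrix.mul_one]
    simp only [this, ← Matrix.sum_mul, ← Matrix.mul_sum, hA]
    split_ifs
    · exact hdA
    · simp
  · intro s s'
    have : ∀ i, (Uᴴ * M i s * W)ᴴ * (Uᴴ * M i s' * W) = Wᴴ * ((M i s)ᴴ * M i s') * W := fun i => by
      rw [show (Uᴴ * M i s * W)ᴴ * (Uᴴ * M i s' * W) = Wᴴ * ((M i s)ᴴ * (U * Uᴴ) * M i s') * W by
        simp only [Matrix.conjTranspose_mul, Matrix.conjTranspose_conjTranspose, Matrix.mul_assoc],
        hUU, Matrix.mul_one]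
    simp only [this, ← Matrix.sum_mul, ← Matrix.mul_sum, hB]
    split_ifs
    · exact hdB
    · simp

end Core

/-! ### Polarization: from states to matrix units -/

section Polarization

variable {ι : Type*} [Fintype ι] [DecidableEq ι]

/-- The pure state of a unit vector. -/
def QState.pure (v : ι → ℂ) (hv : v ⬝ᵥ star v = 1) : QState ι where
  mat := Matrix.vecMulVec v (star v)
  posSemidef := Matrix.posSemidef_vecMulVec_self_star v
  trace_eq_one := by rw [Matrix.trace_vecMulVec, hv]

/-- Basis states give the diagonal units. Equal superpositions of two basis vectors, with relative
phases `1` and `I`, isolate the off-diagonal ones. -/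
theorem map_single_of_map_state_eq {E : Type*} [AddCommGroup E] [Module ℂ E]
    (L : Matrix ι ι ℂ →ₗ[ℂ] E) (τ : E) (h : ∀ ρ : QState ι, L ρ.mat = τ) (s s' : ι) :
    L (Matrix.single s s' 1) = if s = s' then τ else 0 := by
  have hd : ∀ s, L (Matrix.single s s 1) = τ := fun s => by
    rw [← h (QState.pure (Pi.single s 1) (by simp [dotProduct, Pi.single_apply]))]
    congr 1
    ext i j
    simp [QState.pure, Matrix.vecMulVec_apply, Matrix.single_apply, Pi.single_apply, ite_and,
      eq_comm]
    split_ifs <;> rfl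
  rcases eq_or_ne s s' with rfl | hs
  · simp [hd]
  -- In the state of `(e_s + c e_s') / √2` the diagonal part already contributes `τ`, so the cross
  -- terms must map to zero.
  have hoff : ∀ c : ℂ, c * star c = 1 →
      star c • L (Matrix.single s s' 1) + c • L (Matrix.single s' s 1) = 0 := fun c hc => by
    have hv : ((√2⁻¹ : ℝ) : ℂ) * ((√2⁻¹ : ℝ) : ℂ) = 2⁻¹ := by
      rw [← Complex.ofReal_mul, Real.mul_self_sqrt (by norm_num)]
      norm_num
    set r : ℂ := ((√2⁻¹ : ℝ) : ℂ) with hr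
    have hrs : star r = r := Complex.conj_ofReal _
    set v : ι → ℂ := r • (Pi.single s 1 + c • Pi.single s' 1) with hvdef
    have hvv : Matrix.vecMulVec v (star v) = (2⁻¹ : ℂ) • (Matrix.single s s 1 +
        Matrix.single s' s' 1 + (star c • Matrix.single s s' 1 + c • Matrix.single s' s 1)) := by
      have e1 : Matrix.single s' s' (1 : ℂ) = (c * star c) • Matrix.single s' s' 1 := by
        rw [hc, one_smul]
      rw [e1, hvdef, star_smul, hrs, Matrix.smul_vecMulVec, Matrix.vecMulVec_smul, smul_smul, hv,
        star_add, star_smul, Pi.star_single, Pi.star_single, star_one, Matrix.add_vecMulVec,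
        Matrix.vecMulVec_add, Matrix.vecMulVec_add, Matrix.smul_vecMulVec, Matrix.smul_vecMulVec,
        Matrix.vecMulVec_smul, Matrix.vecMulVec_smul]
      simp only [← Matrix.single_eq_single_vecMulVec_single, smul_smul]
      congr 1
      abel
    have htr : v ⬝ᵥ star v = 1 := by
      rw [← Matrix.trace_vecMulVec, hvv]
      simp [Matrix.trace_single_eq_of_ne, hs, hs.symm]
      norm_num
    have := h (QState.pure v htr)
    rw [QState.pure] at this
    simp only [hvv, map_smul, map_add, hd] at this
    have h2 := congrArg (fun x => (2 : ℂ) • x) this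
    simp only [smul_smul, mul_inv_cancel₀ (two_ne_zero' ℂ), one_smul, two_smul] at h2
    exact add_eq_left.1 h2
  rw [if_neg hs]
  have h1 := hoff 1 (by simp)
  have h2 := hoff Complex.I (by simp)
  simp only [star_one, one_smul, RCLike.star_def, Complex.conj_I, neg_smul] at h1 h2
  -- Phase `1` says that the two off-diagonal images sum to zero; phase `I`, multiplied by `I`, says
  -- that their difference is zero.
  have h3 := congrArg (fun x => Complex.I • x) h2
  simp only [smul_add, smul_neg, smul_smul, Complex.I_mul_I, neg_smul, neg_neg, one_smul,
    smul_zero] at h3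
  have h4 : (2 : ℂ) • L (Matrix.single s s' 1) = 0 := by
    rw [two_smul]
    calc _ = (L (Matrix.single s s' 1) + L (Matrix.single s' s 1)) +
        (L (Matrix.single s s' 1) + -L (Matrix.single s' s 1)) := by abel
      _ = 0 := by rw [h1, h3, add_zero]
  exact (smul_eq_zero.1 h4).resolve_left two_ne_zero

end Polarization

/-! ### Partial traces and the operators of a dilation -/

theorem partialTraceA_trace {α β : Type*} [Fintype α] [Fintype β]
    (M : Matrix (α × β) (α × β) ℂ) : (partialTraceA M).trace = M.trace := by
  simp only [partialTraceA, Matrix.trace, Matrix.diag, Matrix.of_apply, Fintype.sum_prod_type]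
  exact Finset.sum_comm

theorem partialTraceB_trace {α β : Type*} [Fintype α] [Fintype β]
    (M : Matrix (α × β) (α × β) ℂ) : (partialTraceB M).trace = M.trace := by
  simp only [partialTraceB, Matrix.trace, Matrix.diag, Matrix.of_apply, Fintype.sum_prod_type]

/-- The partial trace `Tr_A` as a linear map. -/
def partialTraceALin (α β : Type*) [Fintype α] : Matrix (α × β) (α × β) ℂ →ₗ[ℂ] Matrix β β ℂ where
  toFun := partialTraceA
  map_add' M N := by ext; simp [partialTraceA, Finset.sum_add_distrib]
  map_smul' c M := by ext; simp [partialTraceA, Finset.mul_sum]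

/-- The partial trace `Tr_B` as a linear map. -/
def partialTraceBLin (α β : Type*) [Fintype β] : Matrix (α × β) (α × β) ℂ →ₗ[ℂ] Matrix α α ℂ where
  toFun := partialTraceB
  map_add' M N := by ext; simp [partialTraceB, Finset.sum_add_distrib]
  map_smul' c M := by ext; simp [partialTraceB, Finset.mul_sum]

section Dilation

variable {S n α β : Type*} [Fintype n] [DecidableEq n] [Fintype S]

/-- The map `X ↦ W (X ⊗ D) W†`, with `D` diagonal with entries `l`. -/
def dilate (W : Matrix (α × β) (S × n) ℂ) (l : n → ℝ) :
    Matrix S S ℂ →ₗ[ℂ] Matrix (α × β) (α × β) ℂ where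
  toFun X := W * (X ⊗ₖ Matrix.diagonal fun i => (l i : ℂ)) * Wᴴ
  map_add' X Y := by rw [Matrix.add_kronecker, Matrix.mul_add, Matrix.add_mul]
  map_smul' c X := by
    rw [Matrix.smul_kronecker, Matrix.mul_smul, Matrix.smul_mul, RingHom.id_apply]

theorem dilate_apply (W : Matrix (α × β) (S × n) ℂ) (l : n → ℝ) (X : Matrix S S ℂ)
    (p q : α × β) :
    dilate W l X p q = ∑ s, ∑ s', X s s' * ∑ i, l i * (W p (s, i) * star (W q (s', i))) := by
  simp only [dilate, LinearMap.coe_mk, AddHom.coe_mk, Matrix.mul_apply, Fintype.sum_prod_type,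
    Matrix.kronecker_apply, Matrix.diagonal_apply, Matrix.conjTranspose_apply, mul_ite, mul_zero,
    Finset.sum_ite_eq', Finset.mem_univ, if_true]
  simp only [Finset.sum_mul, Finset.mul_sum]
  rw [Finset.sum_congr rfl fun s' _ => Finset.sum_comm, Finset.sum_comm]
  refine Finset.sum_congr rfl fun s _ => Finset.sum_congr rfl fun s' _ =>
    Finset.sum_congr rfl fun i _ => ?_
  ring

variable [DecidableEq S]

theorem dilate_single_apply (W : Matrix (α × β) (S × n) ℂ) (l : n → ℝ) (s s' : S)
    (p q : α × β) :
    dilate W l (Matrix.single s s' 1) p q = ∑ i, l i * (W p (s, i) * star (W q (s', i))) := by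
  rw [dilate_apply, Finset.sum_eq_single s, Finset.sum_eq_single s']
  · simp
  · intro t _ ht
    simp [ht.symm]
  · simp
  · intro t _ ht
    simp [ht.symm]
  · simp

theorem ofReal_sqrt_mul_self {x : ℝ} (hx : 0 ≤ x) : (√x : ℂ) * (√x : ℂ) = x := by
  rw [← Complex.ofReal_mul, Real.mul_self_sqrt hx]

/-- The weighted columns of `W`, as matrices. -/
noncomputable def dilateKraus (W : Matrix (α × β) (S × n) ℂ) (l : n → ℝ) (i : n) (s : S) :
    Matrix α β ℂ :=
  Matrix.of fun a b => (√(l i) : ℂ) * W (a, b) (s, i)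

theorem partialTraceB_dilate_single [Fintype β] (W : Matrix (α × β) (S × n) ℂ) {l : n → ℝ} (hl : ∀ i, 0 ≤ l i)
    (s s' : S) :
    partialTraceB (dilate W l (Matrix.single s s' 1)) =
      ∑ i, dilateKraus W l i s * (dilateKraus W l i s')ᴴ := by
  ext a a'
  simp only [partialTraceB, Matrix.of_apply, dilate_single_apply, Matrix.sum_apply, dilateKraus,
    Matrix.mul_apply, Matrix.conjTranspose_apply, star_mul', RCLike.star_def, Complex.conj_ofReal]
  rw [Finset.sum_comm]
  refine Finset.sum_congr rfl fun i _ => Finset.sum_congr rfl fun b _ => ?_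
  have h := ofReal_sqrt_mul_self (hl i)
  linear_combination -(W (a, b) (s, i) * starRingEnd ℂ (W (a', b) (s', i))) * h

/-- Summing over the row index produces `Mᵀ` times an entrywise conjugate. The transpose turns this
into a product `Mᴴ * M`, at the price of exchanging `s` and `s'`. -/
theorem partialTraceA_dilate_single [Fintype α] (W : Matrix (α × β) (S × n) ℂ) {l : n → ℝ} (hl : ∀ i, 0 ≤ l i)
    (s s' : S) :
    (partialTraceA (dilate W l (Matrix.single s s' 1)))ᵀ =
      ∑ i, (dilateKraus W l i s')ᴴ * dilateKraus W l i s := by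
  ext b b'
  simp only [partialTraceA, Matrix.of_apply, Matrix.transpose_apply, dilate_single_apply,
    Matrix.sum_apply, dilateKraus, Matrix.mul_apply, Matrix.conjTranspose_apply, star_mul',
    RCLike.star_def, Complex.conj_ofReal]
  rw [Finset.sum_comm]
  refine Finset.sum_congr rfl fun i _ => Finset.sum_congr rfl fun a _ => ?_
  have h := ofReal_sqrt_mul_self (hl i)
  linear_combination -(W (a, b') (s, i) * starRingEnd ℂ (W (a, b) (s', i))) * h

variable [Fintype α] [Fintype β]

theorem trace_dilate (W : Matrix (α × β) (S × n) ℂ) (hW : Wᴴ * W = 1) (l : n → ℝ)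
    (X : Matrix S S ℂ) : (dilate W l X).trace = X.trace * ∑ i, (l i : ℂ) := by
  simp only [dilate, LinearMap.coe_mk, AddHom.coe_mk]
  rw [Matrix.trace_mul_comm, ← Matrix.mul_assoc, hW, Matrix.one_mul, Matrix.trace_kronecker,
    Matrix.trace_diagonal]

end Dilation

/-- Each column of the isometry `W` is a unit vector, so only the weight `l i` remains. -/
theorem trace_dilateKraus {S n α β : Type*} [DecidableEq S] [DecidableEq n] [Fintype α] [Fintype β]
    (W : Matrix (α × β) (S × n) ℂ) (hW : Wᴴ * W = 1) {l : n → ℝ}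
    (hl : ∀ i, 0 ≤ l i) (i : n) (s : S) :
    ((dilateKraus W l i s)ᴴ * dilateKraus W l i s).trace.re = l i := by
  rw [Matrix.re_trace_conjTranspose_mul_self]
  have h := congrArg Complex.re (congrFun (congrFun hW (s, i)) (s, i))
  simp only [Matrix.mul_apply, Matrix.conjTranspose_apply, RCLike.star_def, Matrix.one_apply_eq,
    mul_comm (starRingEnd ℂ _), Complex.mul_conj, Complex.re_sum, Complex.ofReal_re,
    Complex.one_re, Fintype.sum_prod_type] at h
  simp only [dilateKraus, Matrix.of_apply, Complex.normSq_mul, Complex.normSq_ofReal,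
    Real.mul_self_sqrt (hl i), ← Finset.mul_sum, h, mul_one]


/-! ### Necessity of the entropy bound -/

namespace RandomizedProcess

variable {d : ℕ} {ι : Type*} [Fintype ι] [DecidableEq ι]

/-- The isometry implemented by the process, with the randomness source in its eigenbasis. -/
noncomputable def isom (P : RandomizedProcess d ι) (ζ : QState ι) :
    Matrix (Fin P.dimA × Fin P.dimB) (Fin d × ι) ℂ :=
  P.V * (P.inA ⊗ₖ (P.inB * ζ.eigU))

theorem isom_isometry (P : RandomizedProcess d ι) (ζ : QState ι) :
    (P.isom ζ)ᴴ * P.isom ζ = 1 := by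
  have hV : P.Vᴴ * P.V = 1 := Unitary.star_mul_self_of_mem P.V_unitary
  rw [isom, Matrix.conjTranspose_mul, Matrix.mul_assoc, ← Matrix.mul_assoc _ P.V, hV,
    Matrix.one_mul, Matrix.conjTranspose_kronecker, ← Matrix.mul_kronecker_mul, P.inA_isometry,
    Matrix.conjTranspose_mul, Matrix.mul_assoc, ← Matrix.mul_assoc _ P.inB, P.inB_isometry,
    Matrix.one_mul, ζ.conjTranspose_eigU_mul_eigU, Matrix.one_kronecker_one]

theorem output_eq_dilate (P : RandomizedProcess d ι) (ζ : QState ι) (ρ : QState (Fin d)) :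
    P.output ζ ρ = dilate (P.isom ζ) ζ.eig ρ.mat := by
  simp only [output, dilate, isom, LinearMap.coe_mk, AddHom.coe_mk]
  have h : (P.inA * ρ.mat * P.inAᴴ) ⊗ₖ (P.inB * ζ.mat * P.inBᴴ) =
      (P.inA ⊗ₖ (P.inB * ζ.eigU)) * (ρ.mat ⊗ₖ Matrix.diagonal fun i => (ζ.eig i : ℂ)) *
        (P.inA ⊗ₖ (P.inB * ζ.eigU))ᴴ := by
    rw [Matrix.conjTranspose_kronecker, Matrix.conjTranspose_mul, ← Matrix.mul_kronecker_mul,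
      ← Matrix.mul_kronecker_mul]
    conv_lhs => rw [ζ.mat_eq]
    simp only [Matrix.mul_assoc]
  rw [h, Matrix.conjTranspose_mul]
  simp only [Matrix.mul_assoc]

/-- Polarization supplies the marginal hypotheses of `sum_re_trace_le_of_marginals`. Both marginals
have trace one and each of the `d` operators at `i` has weight `ζ.eig i`, so the bound reads `2 * (d
* ζ.eig i) ≤ 2`. -/
theorem IsMasking.mul_eig_le_one {P : RandomizedProcess d ι} {ζ : QState ι} (hP : P.IsMasking ζ)
    (hd : 1 ≤ d) (i : ι) : d * ζ.eig i ≤ 1 := by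
  have : Nonempty (Fin d) := ⟨⟨0, hd⟩⟩
  let ρ₀ : QState (Fin d) := QState.pure (Pi.single ⟨0, hd⟩ 1)
    (by simp [dotProduct, Pi.single_apply])
  set W := P.isom ζ
  have hA := map_single_of_map_state_eq
    ((partialTraceALin (Fin P.dimA) (Fin P.dimB)).comp (dilate W ζ.eig))
    (partialTraceA (P.output ζ ρ₀)) fun ρ => by
      rw [← (hP ρ ρ₀).1, output_eq_dilate]
      rfl
  have hB := map_single_of_map_state_eq
    ((partialTraceBLin (Fin P.dimA) (Fin P.dimB)).comp (dilate W ζ.eig))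
    (partialTraceB (P.output ζ ρ₀)) fun ρ => by
      rw [← (hP ρ ρ₀).2, output_eq_dilate]
      rfl
  have htr : (P.output ζ ρ₀).trace = 1 := by
    rw [output_eq_dilate, trace_dilate _ (P.isom_isometry ζ), ρ₀.trace_eq_one, one_mul,
      ← Complex.ofReal_sum, ζ.sum_eig, Complex.ofReal_one]
  have key := sum_re_trace_le_of_marginals (dilateKraus W ζ.eig)
    (partialTraceB (P.output ζ ρ₀)) (partialTraceA (P.output ζ ρ₀))ᵀ
    (fun s s' => (partialTraceB_dilate_single W ζ.eig_nonneg s s').symm.trans (hB s s'))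
    (fun s s' => (partialTraceA_dilate_single W ζ.eig_nonneg s' s).symm.trans ?_) i
  · simp only [trace_dilateKraus W (P.isom_isometry ζ) ζ.eig_nonneg, Finset.sum_const,
      Finset.card_univ, Fintype.card_fin, nsmul_eq_mul, Matrix.trace_transpose,
      partialTraceA_trace, partialTraceB_trace, htr, Complex.one_re] at key
    linarith
  · have := congrArg Matrix.transpose (hA s' s)
    refine this.trans ?_
    simp only [eq_comm (a := s')]
    split_ifs <;> simp

end RandomizedProcess

/-! ### Sufficiency: masking by a coherent measurement -/

section DiagonalIsometry

variable {S n κ : Type*} [Fintype S] [Fintype n] [DecidableEq n] [DecidableEq κ]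

theorem dilate_apply_of_diagonal (W : Matrix (κ × κ) (S × n) ℂ) (l : n → ℝ)
    (g : κ → S × n → ℂ)
    (hW : ∀ p, l p.2 ≠ 0 → ∀ a b, W (a, b) p = if a = b then g a p else 0)
    (X : Matrix S S ℂ) (a b a' b' : κ) :
    dilate W l X (a, b) (a', b') = if a = b ∧ a' = b' then
      ∑ s, ∑ s', X s s' * ∑ i, l i * (g a (s, i) * star (g a' (s', i))) else 0 := by
  have h : ∀ s s' i, (l i : ℂ) * (W (a, b) (s, i) * star (W (a', b') (s', i))) =
      if a = b ∧ a' = b' then l i * (g a (s, i) * star (g a' (s', i))) else 0 := fun s s' i => by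
    rcases eq_or_ne (l i) 0 with h0 | h0
    · simp [h0]
    · rw [hW (s, i) h0, hW (s', i) h0]
      by_cases h1 : a = b <;> by_cases h2 : a' = b' <;> simp [h1, h2]
  rw [dilate_apply]
  simp only [h]
  split_ifs <;> simp

variable [DecidableEq S] [Fintype κ]

/-- The columns of `W` are combinations of the vectors `|k k⟩`. Tracing out either copy of `k` kills
coherence between different `k` and leaves the outcome distribution, which `hq` makes independent of
the input. -/
theorem partialTrace_dilate_of_diagonal (W : Matrix (κ × κ) (S × n) ℂ) (l : n → ℝ)
    (g : κ → S × n → ℂ)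
    (hW : ∀ p, l p.2 ≠ 0 → ∀ a b, W (a, b) p = if a = b then g a p else 0) (q : κ → ℂ)
    (hq : ∀ k s s', ∑ i, l i * (g k (s, i) * star (g k (s', i))) = if s = s' then q k else 0)
    (X : Matrix S S ℂ) :
    partialTraceA (dilate W l X) = Matrix.diagonal (fun k => X.trace * q k) ∧
    partialTraceB (dilate W l X) = Matrix.diagonal (fun k => X.trace * q k) := by
  have hd : ∀ a, (∑ s, ∑ s', X s s' * ∑ i, l i * (g a (s, i) * star (g a (s', i)))) =
      X.trace * q a := fun a => by
    simp only [hq]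
    simp [Matrix.trace, Finset.sum_mul]
  constructor <;> ext a a' <;>
  · simp only [partialTraceA, partialTraceB, Matrix.of_apply,
      dilate_apply_of_diagonal W l g hW X, Matrix.diagonal_apply]
    rw [Finset.sum_eq_single a]
    · rcases eq_or_ne a a' with rfl | h
      · simp only [and_self, if_true, hd]
      · simp [h, h.symm]
    · intro b _ hb
      simp [hb, hb.symm]
    · simp

end DiagonalIsometry

/-- A state masks `d`-dimensional information if there is a rank-one measurement of the input and
of the randomness source whose outcome `k` has a probability `q k` independent of the input. -/
theorem QState.canMask_of_measurement {ι K : Type*} [Fintype ι] [DecidableEq ι] [Fintype K]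
    (σ : QState ι) {d : ℕ} (hd : d ≤ Fintype.card K) (hι : Fintype.card ι ≤ Fintype.card K)
    (g : K → Fin d × ι → ℂ)
    (hg : ∀ p p', σ.eig p.2 ≠ 0 → σ.eig p'.2 ≠ 0 →
      ∑ k, g k p' * star (g k p) = if p = p' then 1 else 0)
    (q : K → ℂ) (hq : ∀ k s s', ∑ i, σ.eig i * (g k (s, i) * star (g k (s', i))) =
      if s = s' then q k else 0) : σ.CanMask d := by
  set m := Fintype.card K
  let e : K ≃ Fin m := Fintype.equivFin K
  obtain ⟨fA⟩ : Nonempty (Fin d ↪ Fin m) := Function.Embedding.nonempty_of_card_le (by simpa)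
  obtain ⟨fB⟩ : Nonempty (ι ↪ Fin m) := Function.Embedding.nonempty_of_card_le (by simpa)
  let F : Fin d × ι → Fin m × Fin m := Prod.map fA fB
  have hF : Function.Injective F := fA.injective.prodMap fB.injective
  let u : Fin d × ι → EuclideanSpace ℂ (Fin m × Fin m) := fun p =>
    WithLp.toLp 2 fun ab => if ab.1 = ab.2 then g (e.symm ab.1) p else 0
  -- Only columns that meet the support of `σ` are prescribed; an arbitrary completion to an
  -- orthonormal basis gives the unitary.
  let T : Set (Fin m × Fin m) := F '' {p | σ.eig p.2 ≠ 0}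
  have hT : Orthonormal ℂ (T.domRestrict (Function.extend F u 0)) := by
    rw [orthonormal_iff_ite]
    rintro ⟨_, p, hp, rfl⟩ ⟨_, p', hp', rfl⟩
    have hiff : ((⟨F p, ⟨p, hp, rfl⟩⟩ : T) = ⟨F p', ⟨p', hp', rfl⟩⟩) ↔ p = p' := by
      rw [Subtype.ext_iff]
      exact hF.eq_iff
    simp only [Set.domRestrict_apply, hF.extend_apply]
    refine Eq.trans ?_ ((hg p p' hp hp').trans (if_congr hiff.symm rfl rfl))
    rw [EuclideanSpace.inner_eq_star_dotProduct]
    simp only [u, dotProduct, Fintype.sum_prod_type, Pi.star_apply, apply_ite star, star_zero,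
      mul_ite, mul_zero, ite_mul, zero_mul, Finset.sum_ite_eq, Finset.mem_univ, if_true]
    simpa using e.symm.sum_comp fun k => g k p' * star (g k p)
  obtain ⟨b, hb⟩ := hT.exists_orthonormalBasis_extension_of_card_eq (by simp)
  have hbu : ∀ p, σ.eig p.2 ≠ 0 → b (F p) = u p := fun p hp => by
    rw [hb _ ⟨p, hp, rfl⟩, hF.extend_apply]
  let JB : Matrix (Fin m) ι ℂ := Matrix.of fun y i => if y = fB i then 1 else 0
  have hJB : JBᴴ * JB = 1 := by
    ext i j
    simp [JB, Matrix.mul_apply, Matrix.one_apply, apply_ite star]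
    exact if_congr eq_comm rfl rfl
  let P : RandomizedProcess d ι :=
    { dimA := m
      dimB := m
      inA := Matrix.of fun x s => if x = fA s then 1 else 0
      inA_isometry := by
        ext i j
        simp [Matrix.mul_apply, Matrix.one_apply, apply_ite star]
        exact if_congr eq_comm rfl rfl
      -- Passing to the eigenbasis here cancels the `eigU` in `isom`, so that the columns of `isom`
      -- are basis vectors `b (F p)`.
      inB := JB * σ.eigUᴴ
      inB_isometry := by
        rw [Matrix.conjTranspose_mul, Matrix.mul_assoc, ← Matrix.mul_assoc JBᴴ, hJB,
          Matrix.one_mul, Matrix.conjTranspose_conjTranspose, σ.eigU_mul_conjTranspose_eigU]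
      V := Matrix.of fun ab xy => b xy ab
      V_unitary := by
        rw [Matrix.mem_unitaryGroup_iff']
        ext x y
        have := orthonormal_iff_ite.1 b.orthonormal x y
        rw [EuclideanSpace.inner_eq_star_dotProduct] at this
        simpa [Matrix.mul_apply, Matrix.one_apply, dotProduct, mul_comm] using this }
  have hW : ∀ p, σ.eig p.2 ≠ 0 → ∀ x y : Fin m, P.isom σ (x, y) p =
      if x = y then g (e.symm x) p else 0 := fun p hp x y => by
    have h1 : P.isom σ (x, y) p = b (F p) (x, y) := by
      rw [RandomizedProcess.isom]
      simp only [P, Matrix.mul_assoc, σ.conjTranspose_eigU_mul_eigU, Matrix.mul_one]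
      simp only [JB, Matrix.mul_apply, Fintype.sum_prod_type, Matrix.of_apply]
      simp [F, Prod.map]
    rw [h1, hbu p hp]
  refine ⟨P, fun ρ ρ' => ?_⟩
  have key := fun X => partialTrace_dilate_of_diagonal (P.isom σ) σ.eig
    (fun x => g (e.symm x)) hW (fun x => q (e.symm x)) (fun x => hq (e.symm x)) X
  simp only [RandomizedProcess.output_eq_dilate]
  exact ⟨by rw [(key _).1, (key _).1, ρ.trace_eq_one, ρ'.trace_eq_one],
    by rw [(key _).2, (key _).2, ρ.trace_eq_one, ρ'.trace_eq_one]⟩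

theorem sum_sign_mul_sign {S : Type*} [Fintype S] [DecidableEq S] (s s' : S) :
    ∑ ε : S → ℤˣ, ((ε s : ℤ) : ℂ) * ((ε s' : ℤ) : ℂ) =
      if s = s' then 2 ^ Fintype.card S else 0 := by
  split_ifs with h
  · subst h
    have : ∀ ε : S → ℤˣ, ((ε s : ℤ) : ℂ) * ((ε s : ℤ) : ℂ) = 1 := fun ε => by
      rw [← Int.cast_mul, ← Units.val_mul, Int.units_mul_self]
      simp
    simp [this]
  -- Flipping the sign at `s` permutes the sign vectors and negates every term, so the sum equals
  -- its own negative.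
  · have := Equiv.sum_comp (Equiv.mulLeft (Pi.mulSingle s (-1) : S → ℤˣ))
      fun ε : S → ℤˣ => ((ε s : ℤ) : ℂ) * ((ε s' : ℤ) : ℂ)
    simp only [Equiv.coe_mulLeft, Pi.mul_apply, Pi.mulSingle_eq_same,
      Pi.mulSingle_eq_of_ne (Ne.symm h), one_mul, neg_mul, Units.val_neg, Int.cast_neg,
      Finset.sum_neg_distrib] at this
    exact self_eq_neg.1 this.symm

/-- A probability vector with entries at most `1/d` is a mixture of uniform distributions on sets
of size `d`. -/
theorem exists_perm_weights {ι : Type*} [Fintype ι] [DecidableEq ι] {d : ℕ} (l : ι → ℝ)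
    (hl : ∀ i, 0 ≤ l i) (hsum : ∑ i, l i = 1) (h : ∀ i, d * l i ≤ 1) (e : Fin d ↪ ι) :
    ∃ w : Equiv.Perm ι → ℝ, (∀ π, 0 ≤ w π) ∧
      ∀ s i, ∑ π, (if π (e s) = i then w π else 0) = l i := by
  set T : Finset ι := Finset.univ.map e
  have hTc : T.card = d := by simp [T]
  have hTc' : (Tᶜ.card : ℝ) = Fintype.card ι - d := by
    rw [Finset.card_compl, Nat.cast_sub (Finset.card_le_univ T), hTc]
  have hs : ∑ i, (1 - d * l i) = Tᶜ.card := by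
    rw [hTc', Finset.sum_sub_distrib, ← Finset.mul_sum, hsum]
    simp
  -- The `d` rows in `T` are copies of `l`; the mass `1 - d * l i ≥ 0` that column `i` still lacks
  -- is spread evenly over the other rows. Birkhoff's theorem writes `D` as a mixture of
  -- permutations, and row `e s` of the mixture is the claim.
  let D : Matrix ι ι ℝ := fun j i => if j ∈ T then l i else (1 - d * l i) / Tᶜ.card
  have hD : D ∈ doublyStochastic ℝ ι := by
    rw [mem_doublyStochastic_iff_sum]
    refine ⟨fun j i => ?_, fun j => ?_, fun i => ?_⟩
    · simp only [D]
      split_ifs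
      · exact hl i
      · exact div_nonneg (sub_nonneg.2 (h i)) (Nat.cast_nonneg _)
    · by_cases hj : j ∈ T
      · simp [D, hj, hsum]
      · have : (Tᶜ.card : ℝ) ≠ 0 :=
          Nat.cast_ne_zero.2 (Finset.card_ne_zero_of_mem (Finset.mem_compl.2 hj))
        simp only [D, hj, if_false, ← Finset.sum_div, hs]
        exact div_self this
    · have h1 : ∑ j ∈ T, D j i = d * l i := by
        rw [Finset.sum_congr rfl fun j hj => if_pos hj, Finset.sum_const, hTc, nsmul_eq_mul]
      have h2 : ∑ j ∈ Tᶜ, D j i = 1 - d * l i := by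
        rw [Finset.sum_congr rfl fun j hj => if_neg (Finset.mem_compl.1 hj), Finset.sum_const,
          nsmul_eq_mul]
        -- If `T` is everything there is no row to carry the remainder, but then the nonnegative
        -- remainders sum to zero.
        rcases eq_or_ne (Tᶜ.card : ℝ) 0 with h0 | h0
        · rw [h0, zero_mul]
          rw [h0] at hs
          exact ((Finset.sum_eq_zero_iff_of_nonneg fun i _ => sub_nonneg.2 (h i)).1 hs i
            (Finset.mem_univ i)).symm
        · exact mul_div_cancel₀ _ h0
      rw [← Finset.sum_add_sum_compl T, h1, h2]
      ring
  obtain ⟨w, hw0, -, hw⟩ := exists_eq_sum_perm_of_mem_doublyStochastic hD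
  refine ⟨w, hw0, fun s i => ?_⟩
  have := congrFun (congrFun hw (e s)) i
  simpa [Matrix.sum_apply, D, T, Equiv.toPEquiv_apply, PEquiv.toMatrix_apply] using this

theorem QState.canMask_of_mul_eig_le_one {ι : Type*} [Fintype ι] [DecidableEq ι] (σ : QState ι)
    {d : ℕ} (h : ∀ i, d * σ.eig i ≤ 1) : σ.CanMask d := by
  have hdι : d ≤ Fintype.card ι := by
    have := Finset.sum_le_sum fun i (_ : i ∈ Finset.univ) => h i
    rw [← Finset.mul_sum, σ.sum_eig] at this
    simpa using this
  obtain ⟨f⟩ : Nonempty (Fin d ↪ ι) := Function.Embedding.nonempty_of_card_le (by simpa)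
  obtain ⟨w, hw0, hw⟩ := exists_perm_weights σ.eig σ.eig_nonneg σ.sum_eig h f
  have hι : Fintype.card ι ≤ Fintype.card (Equiv.Perm ι × (Fin d → ℤˣ)) := by
    rw [Fintype.card_prod, Fintype.card_perm]
    exact (Nat.self_le_factorial _).trans (Nat.le_mul_of_pos_right _ Fintype.card_pos)
  -- This guarantees a nonzero denominator in `g` whenever `w π > 0`.
  have hwe : ∀ π s, w π ≤ σ.eig (π (f s)) := fun π s => by
    rw [← hw s (π (f s))]
    have := Finset.single_le_sum
      (f := fun π' : Equiv.Perm ι => if π' (f s) = π (f s) then w π' else 0)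
      (fun π' _ => by split_ifs <;> simp [hw0]) (Finset.mem_univ π)
    simpa using this
  have h2 : (2 : ℂ) ^ d ≠ 0 := by positivity
  have hsq : ∀ x : ℝ, 0 ≤ x → (√x : ℂ) * √x = x := fun x hx => ofReal_sqrt_mul_self hx
  have h2sq : (√(2 ^ d) : ℂ) * √(2 ^ d) = 2 ^ d := by
    rw [hsq _ (by positivity)]
    simp
  -- Outcome `(π, ε)` projects onto a signed superposition of the pairs `(s, π (f s))`. Dividing by
  -- `√(σ.eig i)` cancels the source weight, so the outcome has probability `w π / 2 ^ d` for every
  -- input. Injectivity of `π ∘ f` removes the cross terms in that probability; averaging over `ε`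
  -- removes those with `s ≠ s'` in the normalization.
  let g : Equiv.Perm ι × (Fin d → ℤˣ) → Fin d × ι → ℂ := fun k p =>
    if k.1 (f p.1) = p.2 then
      √(w k.1) * ((k.2 p.1 : ℤ) : ℂ) / (√(2 ^ d) * √(σ.eig p.2)) else 0
  have hstar : ∀ k p, star (g k p) = g k p := fun k p => by
    simp only [g]
    split_ifs <;> simp
  refine σ.canMask_of_measurement (hdι.trans hι) hι g ?_ (fun k => w k.1 / 2 ^ d) ?_
  · rintro ⟨s, i⟩ ⟨s', i'⟩ hi hi'
    simp only at hi hi'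
    simp only [hstar]
    have hgg : ∀ k, g k (s', i') * g k (s, i) =
        (if k.1 (f s') = i' ∧ k.1 (f s) = i then (w k.1 : ℂ) else 0) /
          (2 ^ d * (√(σ.eig i') * √(σ.eig i))) *
        (((k.2 s' : ℤ) : ℂ) * ((k.2 s : ℤ) : ℂ)) := fun k => by
      simp only [g]
      by_cases h1 : k.1 (f s') = i' <;> by_cases h3 : k.1 (f s) = i <;> simp only [h1, h3, if_true,
        if_false, and_true, mul_zero, zero_mul, zero_div, and_false]
      rw [← h2sq, ← hsq _ (hw0 k.1), div_mul_div_comm, div_mul_eq_mul_div]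
      congr 1 <;> ring
    simp only [hgg, Fintype.sum_prod_type, ← Finset.mul_sum, sum_sign_mul_sign, Fintype.card_fin]
    rcases eq_or_ne s s' with rfl | hs
    · simp only [if_true]
      rw [← Finset.sum_mul, ← Finset.sum_div]
      rcases eq_or_ne i i' with rfl | hii
      · simp only [and_self, if_true]
        have := congrArg (fun x : ℝ => (x : ℂ)) (hw s i)
        simp only [Complex.ofReal_sum, apply_ite Complex.ofReal, Complex.ofReal_zero] at this
        rw [this, hsq _ (σ.eig_nonneg i)]
        have : (σ.eig i : ℂ) ≠ 0 := by exact_mod_cast hi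
        field_simp
      · have : ∀ π : Equiv.Perm ι, ¬(π (f s) = i' ∧ π (f s) = i) :=
          fun π hπ => hii (hπ.2.symm.trans hπ.1)
        simp [this, hii]
    · simp [hs, hs.symm]
  · rintro ⟨π, ε⟩ s s'
    simp only [hstar]
    rcases eq_or_ne s s' with rfl | hs
    · rw [Finset.sum_eq_single (π (f s)), if_pos rfl]
      · simp only [g, if_true]
        have hε : ((ε s : ℤ) : ℂ) * ((ε s : ℤ) : ℂ) = 1 := by
          rw [← Int.cast_mul, ← Units.val_mul, Int.units_mul_self]
          simp
        rcases (hw0 π).eq_or_lt with h0 | h0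
        · simp [← h0]
        · have hpos : (σ.eig (π (f s)) : ℂ) ≠ 0 := by
            exact_mod_cast (h0.trans_le (hwe π s)).ne'
          rw [div_mul_div_comm, show (√(w π) * ((ε s : ℤ) : ℂ)) * (√(w π) * ((ε s : ℤ) : ℂ)) =
            (√(w π) * √(w π)) * (((ε s : ℤ) : ℂ) * ((ε s : ℤ) : ℂ)) by ring, hε, hsq _ (hw0 π),
            show (√(2 ^ d) * √(σ.eig (π (f s))) * (√(2 ^ d) * √(σ.eig (π (f s)))) : ℂ) =
              (√(2 ^ d) * √(2 ^ d)) * (√(σ.eig (π (f s))) * √(σ.eig (π (f s)))) by ring,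
            h2sq, hsq _ (σ.eig_nonneg _)]
          field_simp
      · intro i _ hi
        simp [g, hi.symm]
      · simp
    · rw [if_neg hs]
      refine Finset.sum_eq_zero fun i _ => ?_
      simp only [g]
      by_cases h1 : π (f s) = i
      · have h3 : π (f s') ≠ i := fun h3 => hs (f.injective (π.injective (h1.trans h3.symm)))
        simp [h3]
      · simp [h1]

/-! ### The theorem -/

theorem mainTheorem3 :
    (∀ {ι : Type*} [Fintype ι] [DecidableEq ι] (σ : QState ι) (d : ℕ), 1 ≤ d →
      (σ.CanMask d ↔ Real.logb 2 (d : ℝ) ≤ σ.minEntropy)) ∧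
    (∀ {ι₁ ι₂ : Type*} [Fintype ι₁] [DecidableEq ι₁] [Fintype ι₂] [DecidableEq ι₂]
      (σ₁ : QState ι₁) (σ₂ : QState ι₂),
      Real.logb 2 (σ₁.maskingPower : ℝ) + Real.logb 2 (σ₂.maskingPower : ℝ) ≤
          Real.logb 2 ((σ₁.tensor σ₂).maskingPower : ℝ) ∧
      (2 ≤ σ₁.maskingPower → 2 ≤ σ₂.maskingPower →
        σ₁.maskingPower + σ₂.maskingPower ≤ (σ₁.tensor σ₂).maskingPower)) := by
  refine ⟨fun σ d hd => ?_, fun σ₁ σ₂ => ⟨?_, fun h₁ h₂ => ?_⟩⟩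
  · rw [σ.logb_le_minEntropy_iff hd]
    exact ⟨fun ⟨_, hP⟩ i => hP.mul_eig_le_one hd i, σ.canMask_of_mul_eig_le_one⟩
  · have p₁ : (0 : ℝ) < σ₁.maskingPower := by exact_mod_cast σ₁.one_le_maskingPower
    have p₂ : (0 : ℝ) < σ₂.maskingPower := by exact_mod_cast σ₂.one_le_maskingPower
    rw [← Real.logb_mul p₁.ne' p₂.ne']
    exact Real.logb_le_logb_of_le one_lt_two (mul_pos p₁ p₂)
      (by exact_mod_cast QState.maskingPower_mul_le σ₁ σ₂)
  · exact (Nat.add_le_mul h₁ h₂).trans (QState.maskingPower_mul_le σ₁ σ₂)
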